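/- Let $\mathbb{K}$ be $\mathbb{R}$ or $\mathbb{C}$; all Banach spaces are over $\mathbb{K}$. A bounded linear operator $T\colon E\to F$ between Banach spaces is $1$-summing if $\sum_n\|T(x_n)\|<\infty$ for every sequence $(x_n)$ in $E$ such that $\sum_n|\varphi(x_n)|<\infty$ for all $\varphi\in E^*$. A Banach operator ideal $(\mathcal I,\|\cdot\|_{\mathcal I})$ assigns to every pair $E,F$ of Banach spaces a linear subspace $\mathcal I(E;F)$ of the space $\mathcal L(E;F)$ of bounded linear operators and a complete norm $\|\cdot\|_{\mathcal I}$ on it, such that $\mathrm{id}_{\mathbb K}\in\mathcal I(\mathbb K;\mathbb K)$ with $\|\mathrm{id}_{\mathbb K}\|_{\mathcal I}=1$ and such that, for all $w\in\mathcal L(E_0;E)$, $u\in\mathcal I(E;F)$ and $v\in\mathcal L(F;F_0)$, one has $v u w\in\mathcal I(E_0;F_0)$ and $\|vuw\|_{\mathcal I}\le\|v\|\,\|u\|_{\mathcal I}\,\|w\|$. **Theorem.** Let $E$ be an infinite-dimensional Banach space that is isomorphic (linearly homeomorphic) to a subspace of $L_1(\mu)$ for some measure $\mu$, let $F$ be a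 Banach space that contains an isomorphic copy of $\ell_1$, and let $(\mathcal I,\|\cdot\|_{\mathcal I})$ be a Banach operator ideal such that the identity operator of $\ell_1$ belongs to $\mathcal I(\ell_1;\ell_1)$. Then there is an infinite-dimensional linear subspace $Y$ of $\mathcal I(E;F)$ such that $(Y,\|\cdot\|_{\mathcal I})$ is a Banach space and every nonzero $T\in Y$ is not $1$-summing. -/

import Mathlib

universe u

/-- `N` restricted to the linear subspace `W` of `V` is a norm, and `(W, N)` is a Banach space. -/
structure IsBanachUnder {𝕜 V : Type*} [RCLike 𝕜] [AddCommGroup V] [Module 𝕜 V]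
    (W : Submodule 𝕜 V) (N : V → ℝ) : Prop where
  nonneg : ∀ v ∈ W, 0 ≤ N v
  eq_zero : ∀ v ∈ W, N v = 0 → v = 0
  smul : ∀ (c : 𝕜), ∀ v ∈ W, N (c • v) = ‖c‖ * N v
  add_le : ∀ v ∈ W, ∀ w ∈ W, N (v + w) ≤ N v + N w
  complete : ∀ x : ℕ → V, (∀ n, x n ∈ W) →
    (∀ ε > 0, ∃ n₀, ∀ m ≥ n₀, ∀ n ≥ n₀, N (x m - x n) < ε) →
    ∃ v ∈ W, Filter.Tendsto (fun n => N (x n - v)) Filter.atTop (nhds 0)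

/-- A Banach operator ideal `(I, ‖·‖_I)` on the class of Banach spaces over `𝕜` (in the universe
`u`): `comp E F` is the component `I(E; F)` and `nrm` is the ideal norm, only meaningful on the
members of the component. `ULift 𝕜` is the scalar field, regarded as a Banach space in the
universe `u`. -/
structure BanachOperatorIdeal (𝕜 : Type) [RCLike 𝕜] where
  comp : ∀ (E F : Type u) [NormedAddCommGroup E] [NormedSpace 𝕜 E] [CompleteSpace E]
    [NormedAddCommGroup F] [NormedSpace 𝕜 F] [CompleteSpace F], Submodule 𝕜 (E →L[𝕜] F)
  nrm : ∀ {E F : Type u} [NormedAddCommGroup E] [NormedSpace 𝕜 E] [CompleteSpace E]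
    [NormedAddCommGroup F] [NormedSpace 𝕜 F] [CompleteSpace F], (E →L[𝕜] F) → ℝ
  isBanach : ∀ (E F : Type u) [NormedAddCommGroup E] [NormedSpace 𝕜 E] [CompleteSpace E]
    [NormedAddCommGroup F] [NormedSpace 𝕜 F] [CompleteSpace F],
    IsBanachUnder (comp E F) (nrm (E := E) (F := F))
  id_scalar_mem : ContinuousLinearMap.id 𝕜 (ULift.{u} 𝕜) ∈ comp (ULift.{u} 𝕜) (ULift.{u} 𝕜)
  nrm_id_scalar : nrm (ContinuousLinearMap.id 𝕜 (ULift.{u} 𝕜)) = 1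
  comp_mem : ∀ {E₀ E F F₀ : Type u}
    [NormedAddCommGroup E₀] [NormedSpace 𝕜 E₀] [CompleteSpace E₀]
    [NormedAddCommGroup E] [NormedSpace 𝕜 E] [CompleteSpace E]
    [NormedAddCommGroup F] [NormedSpace 𝕜 F] [CompleteSpace F]
    [NormedAddCommGroup F₀] [NormedSpace 𝕜 F₀] [CompleteSpace F₀]
    (v : F →L[𝕜] F₀) (u : E →L[𝕜] F) (w : E₀ →L[𝕜] E),
    u ∈ comp E F → (v.comp u).comp w ∈ comp E₀ F₀
  nrm_comp_le : ∀ {E₀ E F F₀ : Type u}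
    [NormedAddCommGroup E₀] [NormedSpace 𝕜 E₀] [CompleteSpace E₀]
    [NormedAddCommGroup E] [NormedSpace 𝕜 E] [CompleteSpace E]
    [NormedAddCommGroup F] [NormedSpace 𝕜 F] [CompleteSpace F]
    [NormedAddCommGroup F₀] [NormedSpace 𝕜 F₀] [CompleteSpace F₀]
    (v : F →L[𝕜] F₀) (u : E →L[𝕜] F) (w : E₀ →L[𝕜] E),
    u ∈ comp E F → nrm ((v.comp u).comp w) ≤ ‖v‖ * nrm u * ‖w‖

/-- `E ∈ Space(I)`: the identity operator of `E` belongs to the ideal. -/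
def BanachOperatorIdeal.MemSpace {𝕜 : Type} [RCLike 𝕜] (I : BanachOperatorIdeal.{u} 𝕜)
    (E : Type u) [NormedAddCommGroup E] [NormedSpace 𝕜 E] [CompleteSpace E] : Prop :=
  ContinuousLinearMap.id 𝕜 E ∈ I.comp E E

/-- The Banach space `ℓ₁` of absolutely summable scalar sequences, placed in the universe `u`
by indexing the sequences by a copy of `ℕ` in that universe. -/
abbrev EllOne (𝕜 : Type) [RCLike 𝕜] : Type u := lp (fun _ : ULift.{u} ℕ => 𝕜) 1

/-- `E` is isomorphic (linearly homeomorphic) to a subspace of `X`; in other words,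
`X` contains an isomorphic copy of `E`. -/
def IsIsomorphicToSubspace (𝕜 : Type*) [RCLike 𝕜] (E X : Type*)
    [NormedAddCommGroup E] [NormedSpace 𝕜 E] [NormedAddCommGroup X] [NormedSpace 𝕜 X] : Prop :=
  ∃ S : Submodule 𝕜 X, Nonempty (E ≃L[𝕜] S)

/-- The sequence `x` in `E` is weakly `1`-summable. -/
def WeaklySummableSeq (𝕜 : Type*) [RCLike 𝕜] {E : Type*} [NormedAddCommGroup E]
    [NormedSpace 𝕜 E] (x : ℕ → E) : Prop :=
  ∀ φ : E →L[𝕜] 𝕜, Summable fun n => ‖φ (x n)‖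

/-- `T` is (absolutely) `1`-summing: it sends weakly `1`-summable sequences to absolutely
`1`-summable sequences. -/
def IsOneSumming {𝕜 : Type*} [RCLike 𝕜] {E F : Type*} [NormedAddCommGroup E] [NormedSpace 𝕜 E]
    [NormedAddCommGroup F] [NormedSpace 𝕜 F] (T : E →L[𝕜] F) : Prop :=
  ∀ x : ℕ → E, WeaklySummableSeq 𝕜 x → Summable fun n => ‖T (x n)‖

/-! Everything rests on one operator T : E → ℓ₁ that is not 1-summing
(`exists_not_isOneSumming_into_ellOne`). Given it, tensoring x ↦ a ⊗ x maps ℓ₁ into ℓ₁(ℓ₁) = ℓ₁ and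
multiplies norms by ‖a‖ (`exists_isometric_tensor`). With an embedding J of ℓ₁ into F, bounded below
by δ, put Φ a = J ∘ (a ⊗ ·) ∘ T. Then ‖Φ a x‖ ≥ δ‖a‖‖T x‖, so Φ a is not 1-summing for a ≠ 0. As Φ a
factors through the identity of ℓ₁, its ideal norm is at most a multiple of ‖a‖; as the ideal norm
dominates the operator norm, it is also at least one. Hence Φ embeds ℓ₁ isomorphically into the
ideal component, and Y is its range.

To build T, Dvoretzky–Rogers supplies long finite sequences in E with weak 2-norm at most one and
norms at least 1/5. Inside L₁(μ), averaging over a finite partition sends each such sequence into ℓ₁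
with little loss of norm. These contractions, with geometric weights, are glued into one operator;
the lengths grow fast enough to beat the weights. -/

/-! ### Dvoretzky–Rogers by maximising a determinant -/

section DvoretzkyRogers

/-- The determinant of the map acting as `1 + t` on `V` and as the identity on its orthogonal
complement. -/
theorem det_id_add_smul_starProjection {𝕜 H : Type*} [RCLike 𝕜] [NormedAddCommGroup H]
    [InnerProductSpace 𝕜 H] [FiniteDimensional 𝕜 H] (V : Submodule 𝕜 H) (t : 𝕜) :
    (ContinuousLinearMap.id 𝕜 H + t • V.starProjection).det =
      (1 + t) ^ Module.finrank 𝕜 V := by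
  set D : H →ₗ[𝕜] H := ((ContinuousLinearMap.id 𝕜 H + t • V.starProjection : H →L[𝕜] H) :
    H →ₗ[𝕜] H) with hD
  have hDx : ∀ x, D x = x + t • V.starProjection x := fun x => rfl
  have hV : V ≤ V.comap D := fun x hx => by
    rw [Submodule.mem_comap, hDx]
    exact V.add_mem hx (V.smul_mem _ (V.starProjection_apply_mem x))
  have h1 : D.restrict hV = (1 + t) • LinearMap.id := by
    ext x
    rw [LinearMap.coe_restrict_apply, hDx, Submodule.starProjection_eq_self_iff.mpr x.2]
    simp [add_smul]
  have h2 : V.mapQ V D hV = LinearMap.id := by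
    ext x
    simp only [LinearMap.comp_apply, Submodule.mkQ_apply, Submodule.mapQ_apply, LinearMap.id_apply]
    rw [Submodule.Quotient.eq, hDx, add_sub_cancel_left]
    exact V.smul_mem _ (V.starProjection_apply_mem x)
  change LinearMap.det D = _
  rw [LinearMap.det_eq_det_mul_det V D hV, h1, h2, LinearMap.det_smul]
  simp

/-- Every injective operator from a finite-dimensional Hilbert space can be reparametrized so that
it has norm at most one and its restriction to any subspace of at least half the dimension
has norm at least `1 / 5`. -/
theorem exists_reparametrization_large_on_subspaces {𝕜 H E : Type*} [RCLike 𝕜]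
    [NormedAddCommGroup H] [InnerProductSpace 𝕜 H] [FiniteDimensional 𝕜 H]
    [NormedAddCommGroup E] [NormedSpace 𝕜 E]
    (w : H →L[𝕜] E) (hw : Function.Injective w) :
    ∃ u : H →L[𝕜] E, ‖u‖ ≤ 1 ∧ ∀ V : Submodule 𝕜 H, 0 < Module.finrank 𝕜 V →
      Module.finrank 𝕜 H ≤ 2 * Module.finrank 𝕜 V → ∃ e ∈ V, ‖e‖ = 1 ∧ 1 / 5 ≤ ‖u e‖ := by
  have : ProperSpace (H →L[𝕜] H) := FiniteDimensional.proper 𝕜 _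
  obtain ⟨C, hC0, hC⟩ := (w : H →ₗ[𝕜] E).exists_antilipschitzWith
    (LinearMap.ker_eq_bot.mpr hw)
  -- As for John's ellipsoid, maximise |det A| over the reparametrizations `w ∘ A` of norm at most
  -- one; `w` is bounded below, so this set is compact.
  set K : Set (H →L[𝕜] H) := {A | ‖w.comp A‖ ≤ 1} with hK
  have hKc : IsCompact K := by
    refine Metric.isCompact_of_isClosed_isBounded ?_ ?_
    · exact isClosed_le (by fun_prop) continuous_const
    · refine (isBounded_iff_forall_norm_le).2 ⟨C, fun A hA => ?_⟩
      refine A.opNorm_le_bound C.2 fun x => ?_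
      have h1 := hC.le_mul_dist (A x) 0
      simp only [dist_zero_right, map_zero] at h1
      refine h1.trans (mul_le_mul_of_nonneg_left ?_ C.2)
      calc ‖w (A x)‖ = ‖(w.comp A) x‖ := rfl
        _ ≤ ‖w.comp A‖ * ‖x‖ := ContinuousLinearMap.le_opNorm _ _
        _ ≤ 1 * ‖x‖ := by gcongr; exact hA
        _ = ‖x‖ := one_mul _
  obtain ⟨A, hAK, hA⟩ := hKc.exists_isMaxOn ⟨0, by simp [hK]⟩
    (ContinuousLinearMap.continuous_det (𝕜 := 𝕜) (E := H)).norm.continuousOn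
  have hpos : 0 < ‖A.det‖ := by
    have h1 : (((‖w‖ + 1)⁻¹ : ℝ) : 𝕜) • ContinuousLinearMap.id 𝕜 H ∈ K := by
      simp only [hK, Set.mem_ofPred_eq, ContinuousLinearMap.comp_smul,
        ContinuousLinearMap.comp_id, norm_smul, RCLike.norm_ofReal]
      rw [abs_of_pos (by positivity), inv_mul_le_iff₀ (by positivity)]
      linarith
    refine lt_of_lt_of_le ?_ (hA h1)
    have h2 : ((((‖w‖ + 1)⁻¹ : ℝ) : 𝕜) • ContinuousLinearMap.id 𝕜 H).det =
        (((‖w‖ + 1)⁻¹ : ℝ) : 𝕜) ^ Module.finrank 𝕜 H := by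
      change LinearMap.det ((((‖w‖ + 1)⁻¹ : ℝ) : 𝕜) • (LinearMap.id : H →ₗ[𝕜] H)) = _
      rw [LinearMap.det_smul]; simp
    simp only
    rw [h2, norm_pow, RCLike.norm_ofReal, abs_of_pos (by positivity)]
    positivity
  refine ⟨w.comp A, hAK, fun V hV0 hV => ?_⟩
  by_contra! hcon
  have hsmall : ∀ x ∈ V, ‖w (A x)‖ ≤ 1 / 5 * ‖x‖ := by
    intro x hx
    rcases eq_or_ne x 0 with rfl | hx0
    · simp
    have hn : 0 < ‖x‖ := norm_pos_iff.2 hx0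
    have := hcon (((‖x‖⁻¹ : ℝ) : 𝕜) • x) (V.smul_mem _ hx) (by
      rw [norm_smul, RCLike.norm_ofReal, abs_of_pos (by positivity), inv_mul_cancel₀ hn.ne'])
    rw [ContinuousLinearMap.map_smul, norm_smul, RCLike.norm_ofReal, abs_of_pos (by positivity),
      inv_mul_lt_iff₀ hn] at this
    calc ‖w (A x)‖ ≤ ‖x‖ * (1 / 5) := this.le
      _ = _ := mul_comm _ _
  -- If `w ∘ A` were small on `V`, stretching `V` by 5 and halving would stay in `K`, as 1 + 4/5 ≤
  -- 2. The determinant would grow by 5 ^ dim V / 2 ^ dim H ≥ (5/4) ^ dim V > 1, against maximality.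
  set D : H →L[𝕜] H := ContinuousLinearMap.id 𝕜 H + (4 : 𝕜) • V.starProjection with hD
  have hDK : (2⁻¹ : 𝕜) • A.comp D ∈ K := by
    refine ContinuousLinearMap.opNorm_le_bound _ zero_le_one fun x => ?_
    have h1 : (w.comp ((2⁻¹ : 𝕜) • A.comp D)) x =
        (2⁻¹ : 𝕜) • (w (A x) + (4 : 𝕜) • w (A (V.starProjection x))) := by
      simp [hD]
    have h2 : ‖w (A x)‖ ≤ ‖x‖ := by
      calc ‖w (A x)‖ = ‖(w.comp A) x‖ := rfl
        _ ≤ ‖w.comp A‖ * ‖x‖ := ContinuousLinearMap.le_opNorm _ _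
        _ ≤ 1 * ‖x‖ := by gcongr; exact hAK
        _ = ‖x‖ := one_mul _
    have h3 := hsmall _ (V.starProjection_apply_mem x)
    have h4 := V.norm_starProjection_apply_le x
    have h5 := norm_add_le (w (A x)) ((4 : 𝕜) • w (A (V.starProjection x)))
    rw [norm_smul, RCLike.norm_ofNat] at h5
    rw [h1, norm_smul, norm_inv, RCLike.norm_ofNat]
    linarith [norm_nonneg x]
  have hmax : ‖((2⁻¹ : 𝕜) • A.comp D).det‖ ≤ ‖A.det‖ := hA hDK
  have hdet : ((2⁻¹ : 𝕜) • A.comp D).det =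
      (2⁻¹ : 𝕜) ^ Module.finrank 𝕜 H * (A.det * 5 ^ Module.finrank 𝕜 V) := by
    have h5 : (1 + 4 : 𝕜) = 5 := by norm_num
    rw [← h5, ← det_id_add_smul_starProjection V (4 : 𝕜)]
    change LinearMap.det ((2⁻¹ : 𝕜) • ((A : H →ₗ[𝕜] H) ∘ₗ (D : H →ₗ[𝕜] H))) = _
    rw [LinearMap.det_smul, LinearMap.det_comp]
  rw [hdet, norm_mul, norm_mul, norm_pow, norm_pow, norm_inv, RCLike.norm_ofNat,
    RCLike.norm_ofNat] at hmax
  have hle : (1 / 4 : ℝ) ^ Module.finrank 𝕜 V ≤ 2⁻¹ ^ Module.finrank 𝕜 H := by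
    have : (1 / 4 : ℝ) ^ Module.finrank 𝕜 V = 2⁻¹ ^ (2 * Module.finrank 𝕜 V) := by
      rw [pow_mul]; norm_num
    rw [this]
    exact pow_le_pow_of_le_one (by norm_num) (by norm_num) hV
  have hgt : (1 : ℝ) < (1 / 4 : ℝ) ^ Module.finrank 𝕜 V * 5 ^ Module.finrank 𝕜 V := by
    rw [← mul_pow]
    exact one_lt_pow₀ (by norm_num) hV0.ne'
  have h6 : (1 : ℝ) < 2⁻¹ ^ Module.finrank 𝕜 H * 5 ^ Module.finrank 𝕜 V :=
    hgt.trans_le (mul_le_mul_of_nonneg_right hle (by positivity))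
  nlinarith

/-- A form of the Dvoretzky–Rogers lemma: an infinite-dimensional normed space contains arbitrarily
long finite sequences with weak `2`-norm at most one all of whose members have norm
at least `1 / 5`. -/
theorem exists_weakly_two_summable_of_not_finiteDimensional {𝕜 E : Type*} [RCLike 𝕜]
    [NormedAddCommGroup E] [NormedSpace 𝕜 E] (hE : ¬ FiniteDimensional 𝕜 E) (m : ℕ) :
    ∃ y : Fin m → E, (∀ i, 1 / 5 ≤ ‖y i‖) ∧
      ∀ φ : E →L[𝕜] 𝕜, ∑ i, ‖φ (y i)‖ ^ 2 ≤ ‖φ‖ ^ 2 := by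
  -- With dimension 2m, the orthogonal complement of fewer than m chosen vectors still has at least
  -- half the dimension, so the selection can continue.
  obtain ⟨b, hb⟩ : ∃ f : Fin (2 * m) → E, LinearIndependent 𝕜 f := by
    refine exists_linearIndependent_of_le_rank ?_
    have : Cardinal.aleph0 ≤ Module.rank 𝕜 E := by
      rw [← not_lt, Module.rank_lt_aleph0_iff]; exact hE
    exact (Cardinal.natCast_lt_aleph0).le.trans this
  let H := EuclideanSpace 𝕜 (Fin (2 * m))
  let w : H →L[𝕜] E := LinearMap.toContinuousLinearMap
    ((Fintype.linearCombination 𝕜 b) ∘ₗ (WithLp.linearEquiv 2 𝕜 (Fin (2 * m) → 𝕜)).toLinearMap)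
  have hw : Function.Injective w := by
    intro x y hxy
    have h1 := linearIndependent_iff_injective_fintypeLinearCombination.mp hb
    exact (WithLp.linearEquiv 2 𝕜 (Fin (2 * m) → 𝕜)).injective (h1 hxy)
  obtain ⟨u, hu, hV⟩ := exists_reparametrization_large_on_subspaces w hw
  have hH : Module.finrank 𝕜 H = 2 * m := by simp [H]
  have key : ∀ k ≤ m, ∃ v : Fin k → H, Orthonormal 𝕜 v ∧ ∀ i, 1 / 5 ≤ ‖u (v i)‖ := by
    intro k
    induction k with
    | zero => exact fun _ => ⟨fun i => i.elim0, Orthonormal.of_isEmpty _, fun i => i.elim0⟩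
    | succ k ih =>
      intro hk
      obtain ⟨v, hv, hvu⟩ := ih (by omega)
      set W := Submodule.span 𝕜 (Set.range v)
      have hW : Module.finrank 𝕜 W = k := by
        rw [finrank_span_eq_card hv.linearIndependent, Fintype.card_fin]
      have hsum := W.finrank_add_finrank_orthogonal
      obtain ⟨e, he, he1, heu⟩ := hV Wᗮ (by omega) (by omega)
      refine ⟨Matrix.vecCons e v, orthonormal_vecCons_iff.2 ⟨he1, fun i => ?_, hv⟩, ?_⟩
      · exact (Submodule.mem_orthogonal' W e).1 he _ (Submodule.subset_span ⟨i, rfl⟩)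
      · intro i
        refine Fin.cases ?_ (fun j => ?_) i
        · simpa using heu
        · simpa using hvu j
  obtain ⟨v, hv, hvu⟩ := key m le_rfl
  refine ⟨fun i => u (v i), hvu, fun φ => ?_⟩
  -- The weak 2-norm bound is Bessel's inequality for the Riesz representative of `φ ∘ u`.
  set g := (InnerProductSpace.toDual 𝕜 H).symm (φ.comp u) with hg
  have hgx : ∀ x, φ (u x) = inner 𝕜 g x := fun x => by
    rw [hg, InnerProductSpace.toDual_symm_apply]; rfl
  have hgn : ‖g‖ ≤ ‖φ‖ := by
    rw [hg, LinearIsometryEquiv.norm_map]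
    exact (φ.opNorm_comp_le u).trans (mul_le_of_le_one_right (norm_nonneg _) hu)
  calc ∑ i, ‖φ (u (v i))‖ ^ 2 = ∑ i, ‖inner 𝕜 (v i) g‖ ^ 2 := by
        simp_rw [hgx, norm_inner_symm g]
    _ ≤ ‖g‖ ^ 2 := hv.sum_inner_products_le g
    _ ≤ ‖φ‖ ^ 2 := by gcongr

end DvoretzkyRogers

/-! ### Contractions from L₁(μ) to ℓ₁ by integration over partitions -/

section PartitionIntegrals

open MeasureTheory

/-- Finitely many vectors placed at distinct coordinates of `ℓ₁`. -/
theorem lp_norm_sum_single_one {α κ 𝕜 : Type*} [DecidableEq α] [Fintype κ] [NormedAddCommGroup 𝕜]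
    (ι : κ ↪ α) (g : κ → 𝕜) :
    ‖∑ k, (lp.single 1 (ι k) (g k) : lp (fun _ : α => 𝕜) 1)‖ = ∑ k, ‖g k‖ := by
  have h := lp.norm_sum_single (E := fun _ : α => 𝕜) (p := 1) (by simp)
    (Function.extend ι g 0) (Finset.univ.map ι)
  simpa [Finset.sum_map, ι.injective.extend_apply] using h

/-- The operator from `L₁(μ)` to `ℓ₁` which integrates over the members of a finite family of
disjoint measurable sets. -/
theorem exists_partition_integral_map {𝕜 : Type} [RCLike 𝕜] {Ω κ : Type*} [MeasurableSpace Ω]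
    (μ : Measure Ω) [Fintype κ] (A : κ → Set Ω) (hA : ∀ k, MeasurableSet (A k))
    (hd : Pairwise (Function.onFun Disjoint A)) :
    ∃ T : Lp 𝕜 1 μ →L[𝕜] EllOne.{u} 𝕜, ‖T‖ ≤ 1 ∧
      ∀ f, ‖T f‖ = ∑ k, ‖∫ ω in A k, f ω ∂μ‖ := by
  classical
  obtain ⟨i₀, hi₀⟩ := Countable.exists_injective_nat κ
  let ι : κ ↪ ULift.{u} ℕ := ⟨fun k => ULift.up (i₀ k), fun a b h => hi₀ (ULift.up_injective h)⟩
  have hint : ∀ (f : Lp 𝕜 1 μ) k, IntegrableOn f (A k) μ := fun f k =>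
    (L1.integrable_coeFn f).integrableOn
  let L : Lp 𝕜 1 μ →ₗ[𝕜] EllOne.{u} 𝕜 :=
    { toFun := fun f => ∑ k, lp.single 1 (ι k) (∫ ω in A k, f ω ∂μ)
      map_add' := fun f g => by
        rw [← Finset.sum_add_distrib]
        refine Finset.sum_congr rfl fun k _ => ?_
        rw [← lp.single_add, ← integral_add (hint f k) (hint g k)]
        congr 1
        refine integral_congr_ae (ae_restrict_of_ae ?_)
        filter_upwards [Lp.coeFn_add f g] with ω h
        rw [h]; rfl
      map_smul' := fun c f => by
        rw [RingHom.id_apply, Finset.smul_sum]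
        refine Finset.sum_congr rfl fun k _ => ?_
        rw [← lp.single_smul, ← integral_smul]
        congr 1
        refine integral_congr_ae (ae_restrict_of_ae ?_)
        filter_upwards [Lp.coeFn_smul c f] with ω h
        rw [h]; rfl }
  have hL : ∀ f, ‖L f‖ = ∑ k, ‖∫ ω in A k, f ω ∂μ‖ := fun f => lp_norm_sum_single_one ι _
  have hb : ∀ f, ‖L f‖ ≤ 1 * ‖f‖ := fun f => by
    rw [hL, one_mul, L1.norm_eq_integral_norm]
    calc ∑ k, ‖∫ ω in A k, f ω ∂μ‖ ≤ ∑ k, ∫ ω in A k, ‖f ω‖ ∂μ :=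
          Finset.sum_le_sum fun k _ => norm_integral_le_integral_norm _
      _ = ∫ ω in ⋃ k, A k, ‖f ω‖ ∂μ :=
          (integral_iUnion_fintype hA hd fun k => (hint f k).norm).symm
      _ ≤ _ := setIntegral_le_integral (L1.integrable_coeFn f).norm
          (Filter.Eventually.of_forall fun ω => norm_nonneg _)
  exact ⟨L.mkContinuous 1 hb, L.mkContinuous_norm_le zero_le_one hb, hL⟩

/-- Finitely many elements of `L₁(μ)` can be mapped into `ℓ₁` by a contraction which almost
preserves their norms. -/
theorem exists_contraction_Lp_one_almost_norm_preserving {𝕜 : Type} [RCLike 𝕜] {Ω κ : Type*}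
    [MeasurableSpace Ω] (μ : Measure Ω) [Finite κ] (f : κ → Lp 𝕜 1 μ) {ε : ℝ} (hε : 0 < ε) :
    ∃ T : Lp 𝕜 1 μ →L[𝕜] EllOne.{u} 𝕜, ‖T‖ ≤ 1 ∧ ∀ j, ‖f j‖ - ε ≤ ‖T (f j)‖ := by
  have hdense := Lp.simpleFunc.dense (E := 𝕜) (μ := μ) (p := 1) ENNReal.one_ne_top
  have hex : ∀ j, ∃ g : Lp.simpleFunc 𝕜 1 μ, ‖f j - (g : Lp 𝕜 1 μ)‖ < ε / 2 := fun j => by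
    obtain ⟨g, hg, h⟩ := Metric.mem_closure_iff.1 (hdense (f j)) (ε / 2) (by positivity)
    exact ⟨⟨g, hg⟩, by rwa [← dist_eq_norm]⟩
  choose g hg using hex
  let s : κ → SimpleFunc Ω 𝕜 := fun j => Lp.simpleFunc.toSimpleFunc (g j)
  have hs : ∀ j, s j =ᵐ[μ] (g j : Lp 𝕜 1 μ) := fun j =>
    Lp.simpleFunc.toSimpleFunc_eq_toFun (g j)
  -- The level sets of the joint map make every `s j` constant on each piece, so integrating
  -- piecewise loses none of the norm of `g j`.
  let t : Ω → κ → 𝕜 := fun ω j => s j ω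
  have htm : Measurable t := measurable_pi_iff.2 fun j => (s j).measurable
  have htf : (Set.range t).Finite :=
    (Set.Finite.pi' fun j => (s j).finite_range).subset (by
      rintro _ ⟨ω, rfl⟩ j
      exact ⟨ω, rfl⟩)
  have : Fintype (Set.range t) := htf.fintype
  let A : Set.range t → Set Ω := fun v => t ⁻¹' {v.1}
  have hA : ∀ v, MeasurableSet (A v) := fun v => htm (measurableSet_singleton _)
  have hd : Pairwise (Function.onFun Disjoint A) := fun v w hvw =>
    Disjoint.preimage _ (Set.disjoint_singleton.2 fun h => hvw (Subtype.ext h))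
  have hU : ⋃ v, A v = Set.univ :=
    Set.eq_univ_of_forall fun ω => Set.mem_iUnion.2 ⟨⟨t ω, ω, rfl⟩, rfl⟩
  obtain ⟨T, hT1, hT⟩ := exists_partition_integral_map.{u} μ A hA hd (𝕜 := 𝕜)
  refine ⟨T, hT1, fun j => ?_⟩
  have hTg : ‖T (g j)‖ = ‖(g j : Lp 𝕜 1 μ)‖ := by
    rw [hT, L1.norm_eq_integral_norm, ← setIntegral_univ, ← hU,
      integral_iUnion_fintype hA hd fun k => (L1.integrable_coeFn _).norm.integrableOn]
    refine Finset.sum_congr rfl fun v _ => ?_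
    have h1 : ∀ᵐ ω ∂μ.restrict (A v), (g j : Lp 𝕜 1 μ) ω = v.1 j := by
      filter_upwards [ae_restrict_of_ae (hs j), ae_restrict_mem (hA v)] with ω h1 h2
      rw [← h1, ← (show t ω = v.1 from h2)]
    rw [integral_congr_ae h1, integral_congr_ae (h1.mono fun ω h => congrArg norm h)]
    simp [norm_smul]
  have h1 : ‖T (g j)‖ ≤ ‖T (f j)‖ + ‖f j - g j‖ := by
    have h2 : ‖T (f j - g j)‖ ≤ 1 * ‖f j - g j‖ := T.le_of_opNorm_le hT1 _
    have h3 := norm_sub_norm_le (T (g j)) (T (f j))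
    rw [norm_sub_rev, ← map_sub] at h3
    linarith
  have h4 := norm_sub_norm_le (f j) (g j : Lp 𝕜 1 μ)
  linarith [hg j]

end PartitionIntegrals

/-! ### Flattening ℓ₁(ℓ₁) to ℓ₁ -/

section EllOneGluing

theorem EllOne.summable_norm {𝕜 : Type} [RCLike 𝕜] (x : EllOne.{u} 𝕜) :
    Summable fun i => ‖x i‖ := by
  simpa using (lp.memℓp x).summable (by simp)

theorem EllOne.norm_eq_tsum {𝕜 : Type} [RCLike 𝕜] (x : EllOne.{u} 𝕜) : ‖x‖ = ∑' i, ‖x i‖ := by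
  simpa using lp.norm_eq_tsum_rpow (p := 1) (by simp) x

theorem EllOne.not_finiteDimensional (𝕜 : Type) [RCLike 𝕜] :
    ¬ FiniteDimensional 𝕜 (EllOne.{u} 𝕜) := by
  classical
  intro h
  have hli : LinearIndependent 𝕜
      (fun i : ULift.{u} ℕ => (lp.single 1 i (1 : 𝕜) : EllOne.{u} 𝕜)) := by
    rw [linearIndependent_iff']
    intro s g hg i hi
    have h1 : (∑ j ∈ s, lp.single 1 j (g j) : EllOne.{u} 𝕜) = 0 := by
      rw [← hg]
      refine Finset.sum_congr rfl fun j _ => ?_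
      rw [← lp.single_smul, smul_eq_mul, mul_one]
    have h2 := lp.norm_sum_single (E := fun _ : ULift.{u} ℕ => 𝕜) (p := 1) (by simp) g s
    rw [h1] at h2
    simp only [norm_zero, ENNReal.toReal_one, Real.rpow_one] at h2
    exact norm_eq_zero.1 ((Finset.sum_eq_zero_iff_of_nonneg fun _ _ => norm_nonneg _).1 h2.symm i hi)
  have := hli.finite
  exact not_finite (ULift.{u} ℕ)

/-- A bijection between the index set of `EllOne` and its square. -/
def pairIndexEquiv : ULift.{u} ℕ ≃ ULift.{u} ℕ × ULift.{u} ℕ :=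
  (Equiv.ulift.trans Nat.pairEquiv.symm).trans (Equiv.ulift.symm.prodCongr Equiv.ulift.symm)

theorem summable_glue {𝕜 : Type} [RCLike 𝕜] (a : EllOne.{u} 𝕜) {y : ULift.{u} ℕ → EllOne.{u} 𝕜}
    {C : ℝ} (hy : ∀ i, ‖y i‖ ≤ C) :
    Summable fun p : ULift.{u} ℕ × ULift.{u} ℕ => ‖a p.1 * y p.1 p.2‖ := by
  rw [summable_prod_of_nonneg fun p => norm_nonneg _]
  simp only [norm_mul]
  refine ⟨fun i => (y i).summable_norm.mul_left _, ?_⟩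
  refine Summable.of_nonneg_of_le (fun i => tsum_nonneg fun k => by positivity) (fun i => ?_)
    (a.summable_norm.mul_right C)
  rw [tsum_mul_left, ← EllOne.norm_eq_tsum]
  exact mul_le_mul_of_nonneg_left (hy i) (norm_nonneg _)

/-- The element of `ℓ₁(ℓ₁) = ℓ₁` whose `i`-th block is `a i • y i`. -/
def EllOne.glue {𝕜 : Type} [RCLike 𝕜] (a : EllOne.{u} 𝕜) (y : ULift.{u} ℕ → EllOne.{u} 𝕜)
    (hy : ∃ C : ℝ, ∀ i, ‖y i‖ ≤ C) : EllOne.{u} 𝕜 :=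
  ⟨fun n => a (pairIndexEquiv n).1 * y (pairIndexEquiv n).1 (pairIndexEquiv n).2, by
    obtain ⟨C, hC⟩ := hy
    refine memℓp_gen ?_
    simpa [Function.comp_def] using pairIndexEquiv.summable_iff.2 (summable_glue a hC)⟩

theorem EllOne.glue_apply {𝕜 : Type} [RCLike 𝕜] (a : EllOne.{u} 𝕜)
    (y : ULift.{u} ℕ → EllOne.{u} 𝕜) (hy : ∃ C : ℝ, ∀ i, ‖y i‖ ≤ C) (n : ULift.{u} ℕ) :
    EllOne.glue a y hy n = a (pairIndexEquiv n).1 * y (pairIndexEquiv n).1 (pairIndexEquiv n).2 :=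
  rfl

/-- The separate family `w` lets this apply directly to `T i (x + y)`, with its own proof of
boundedness. -/
theorem EllOne.glue_add_right {𝕜 : Type} [RCLike 𝕜] (a : EllOne.{u} 𝕜)
    {y z w : ULift.{u} ℕ → EllOne.{u} 𝕜} (hy : ∃ C : ℝ, ∀ i, ‖y i‖ ≤ C)
    (hz : ∃ C : ℝ, ∀ i, ‖z i‖ ≤ C) (hw : ∃ C : ℝ, ∀ i, ‖w i‖ ≤ C) (h : ∀ i, w i = y i + z i) :
    EllOne.glue a w hw = EllOne.glue a y hy + EllOne.glue a z hz := by
  refine lp.ext (funext fun n => ?_)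
  rw [lp.coeFn_add, Pi.add_apply, EllOne.glue_apply, EllOne.glue_apply, EllOne.glue_apply, h,
    lp.coeFn_add, Pi.add_apply, mul_add]

theorem EllOne.glue_smul_right {𝕜 : Type} [RCLike 𝕜] (a : EllOne.{u} 𝕜) (c : 𝕜)
    {y w : ULift.{u} ℕ → EllOne.{u} 𝕜} (hy : ∃ C : ℝ, ∀ i, ‖y i‖ ≤ C)
    (hw : ∃ C : ℝ, ∀ i, ‖w i‖ ≤ C) (h : ∀ i, w i = c • y i) :
    EllOne.glue a w hw = c • EllOne.glue a y hy := by
  refine lp.ext (funext fun n => ?_)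
  rw [lp.coeFn_smul, Pi.smul_apply, EllOne.glue_apply, EllOne.glue_apply, h, lp.coeFn_smul,
    Pi.smul_apply, smul_eq_mul, smul_eq_mul, mul_left_comm]

theorem EllOne.glue_add_left {𝕜 : Type} [RCLike 𝕜] (a b : EllOne.{u} 𝕜)
    {y : ULift.{u} ℕ → EllOne.{u} 𝕜} (hy : ∃ C : ℝ, ∀ i, ‖y i‖ ≤ C) :
    EllOne.glue (a + b) y hy = EllOne.glue a y hy + EllOne.glue b y hy := by
  refine lp.ext (funext fun n => ?_)
  rw [lp.coeFn_add, Pi.add_apply, EllOne.glue_apply, EllOne.glue_apply, EllOne.glue_apply,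
    lp.coeFn_add, Pi.add_apply, add_mul]

theorem EllOne.glue_smul_left {𝕜 : Type} [RCLike 𝕜] (c : 𝕜) (a : EllOne.{u} 𝕜)
    {y : ULift.{u} ℕ → EllOne.{u} 𝕜} (hy : ∃ C : ℝ, ∀ i, ‖y i‖ ≤ C) :
    EllOne.glue (c • a) y hy = c • EllOne.glue a y hy := by
  refine lp.ext (funext fun n => ?_)
  rw [lp.coeFn_smul, Pi.smul_apply, EllOne.glue_apply, EllOne.glue_apply, lp.coeFn_smul,
    Pi.smul_apply, smul_eq_mul, smul_eq_mul, mul_assoc]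

/-- Sum the double series block by block. A single block gives the lower bound for glued operators;
constant blocks give the isometric tensor product. -/
theorem EllOne.norm_glue {𝕜 : Type} [RCLike 𝕜] (a : EllOne.{u} 𝕜)
    (y : ULift.{u} ℕ → EllOne.{u} 𝕜) (hy : ∃ C : ℝ, ∀ i, ‖y i‖ ≤ C) :
    ‖EllOne.glue a y hy‖ = ∑' i, ‖a i‖ * ‖y i‖ := by
  obtain ⟨C, hC⟩ := hy
  rw [EllOne.norm_eq_tsum]
  simp only [EllOne.glue_apply]
  rw [pairIndexEquiv.tsum_eq
    (fun p : ULift.{u} ℕ × ULift.{u} ℕ => ‖a p.1 * y p.1 p.2‖),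
    (summable_glue a hC).tsum_prod]
  refine tsum_congr fun i => ?_
  simp only [norm_mul]
  rw [tsum_mul_left, ← EllOne.norm_eq_tsum]

theorem EllOne.summable_norm_mul_norm {𝕜 : Type} [RCLike 𝕜] (a : EllOne.{u} 𝕜)
    {y : ULift.{u} ℕ → EllOne.{u} 𝕜} {C : ℝ} (hC : ∀ i, ‖y i‖ ≤ C) :
    Summable fun i => ‖a i‖ * ‖y i‖ :=
  Summable.of_nonneg_of_le (fun i => by positivity)
    (fun i => mul_le_mul_of_nonneg_left (hC i) (norm_nonneg _)) (a.summable_norm.mul_right C)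

attribute [irreducible] EllOne.glue

/-- A bounded sequence of operators into `ℓ₁` and a weight `a ∈ ℓ₁` are amalgamated into a single
operator into `ℓ₁(ℓ₁) = ℓ₁`. -/
theorem exists_glued_operator {𝕜 : Type} [RCLike 𝕜] {E : Type*} [NormedAddCommGroup E]
    [NormedSpace 𝕜 E] (a : EllOne.{u} 𝕜) (T : ULift.{u} ℕ → E →L[𝕜] EllOne.{u} 𝕜) {C : ℝ}
    (hT : ∀ i, ‖T i‖ ≤ C) :
    ∃ S : E →L[𝕜] EllOne.{u} 𝕜, ∀ i x, ‖a i‖ * ‖T i x‖ ≤ ‖S x‖ := by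
  have hC : 0 ≤ C := (norm_nonneg _).trans (hT ⟨0⟩)
  have hTx : ∀ x i, ‖T i x‖ ≤ C * ‖x‖ := fun x i => (T i).le_of_opNorm_le (hT i) x
  have hbd : ∀ x, ∃ C : ℝ, ∀ i, ‖T i x‖ ≤ C := fun x => ⟨_, hTx x⟩
  let L : E →ₗ[𝕜] EllOne.{u} 𝕜 :=
    { toFun := fun x => EllOne.glue a (fun i => T i x) (hbd x)
      map_add' := fun x y =>
        EllOne.glue_add_right a (hbd x) (hbd y) (hbd (x + y)) fun i => map_add (T i) x y
      map_smul' := fun c x =>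
        EllOne.glue_smul_right a c (hbd x) (hbd (c • x)) fun i => map_smul (T i) c x }
  have hL : ∀ x, ‖L x‖ = ∑' i, ‖a i‖ * ‖T i x‖ := fun x => EllOne.norm_glue a _ (hbd x)
  have hb : ∀ x, ‖L x‖ ≤ (‖a‖ * C) * ‖x‖ := fun x => by
    rw [hL, EllOne.norm_eq_tsum a, mul_assoc, ← tsum_mul_right]
    exact (EllOne.summable_norm_mul_norm a (hTx x)).tsum_le_tsum
      (fun i => mul_le_mul_of_nonneg_left (hTx x i) (norm_nonneg _)) (a.summable_norm.mul_right _)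
  refine ⟨L.mkContinuous _ hb, fun i x => ?_⟩
  rw [LinearMap.mkContinuous_apply, hL]
  exact (EllOne.summable_norm_mul_norm a (hTx x)).le_tsum i fun _ _ => by positivity

/-- A realization of the isometric tensor product `ℓ₁ × ℓ₁ → ℓ₁(ℓ₁) = ℓ₁`. -/
theorem exists_isometric_tensor (𝕜 : Type) [RCLike 𝕜] :
    ∃ B : EllOne.{u} 𝕜 →L[𝕜] EllOne.{u} 𝕜 →L[𝕜] EllOne.{u} 𝕜, ∀ a x, ‖B a x‖ = ‖a‖ * ‖x‖ := by
  have hbd : ∀ x : EllOne.{u} 𝕜, ∃ C : ℝ, ∀ _ : ULift.{u} ℕ, ‖x‖ ≤ C := fun x => ⟨_, fun _ => le_rfl⟩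
  let L : EllOne.{u} 𝕜 →ₗ[𝕜] EllOne.{u} 𝕜 →ₗ[𝕜] EllOne.{u} 𝕜 :=
    LinearMap.mk₂ 𝕜 (fun a x => EllOne.glue a (fun _ => x) (hbd x))
      (fun a b x => EllOne.glue_add_left a b (hbd x))
      (fun c a x => EllOne.glue_smul_left c a (hbd x))
      (fun a x y => EllOne.glue_add_right a (hbd x) (hbd y) (hbd (x + y)) fun _ => rfl)
      (fun c a x => EllOne.glue_smul_right a c (hbd x) (hbd (c • x)) fun _ => rfl)
  have hL : ∀ a x, ‖L a x‖ = ‖a‖ * ‖x‖ := fun a x => by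
    change ‖EllOne.glue a (fun _ => x) (hbd x)‖ = _
    rw [EllOne.norm_glue, tsum_mul_right, ← EllOne.norm_eq_tsum]
  exact ⟨L.mkContinuous₂ 1 fun a x => by rw [hL, one_mul], hL⟩

end EllOneGluing

/-! ### An operator into ℓ₁ that is not 1-summing -/

section NonSumming

theorem ContinuousLinearMap.exists_lower_bound_of_isIsomorphicToSubspace {𝕜 E X : Type*}
    [RCLike 𝕜] [NormedAddCommGroup E] [NormedSpace 𝕜 E] [NormedAddCommGroup X] [NormedSpace 𝕜 X]
    (h : IsIsomorphicToSubspace 𝕜 E X) :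
    ∃ j : E →L[𝕜] X, ∃ δ : ℝ, 0 < δ ∧ ∀ x, δ * ‖x‖ ≤ ‖j x‖ := by
  obtain ⟨S, ⟨e⟩⟩ := h
  set C := ‖(e.symm : S →L[𝕜] E)‖ + 1 with hC
  have hCpos : 0 < C := by positivity
  refine ⟨S.subtypeL.comp (e : E →L[𝕜] S), C⁻¹, inv_pos.2 hCpos, fun x => ?_⟩
  rw [inv_mul_le_iff₀ hCpos]
  calc ‖x‖ = ‖(e.symm : S →L[𝕜] E) (e x)‖ := by simp
    _ ≤ ‖(e.symm : S →L[𝕜] E)‖ * ‖e x‖ := ContinuousLinearMap.le_opNorm _ _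
    _ ≤ C * ‖e x‖ := by gcongr; rw [hC]; linarith

/-- An infinite-dimensional space embedding into `L₁(μ)` admits an operator into `ℓ₁` which is
not `1`-summing. -/
theorem exists_not_isOneSumming_into_ellOne {𝕜 : Type} [RCLike 𝕜] {E : Type*}
    [NormedAddCommGroup E] [NormedSpace 𝕜 E] (hE : ¬ FiniteDimensional 𝕜 E)
    {Ω : Type*} [MeasurableSpace Ω] (μ : MeasureTheory.Measure Ω)
    (hEL : IsIsomorphicToSubspace 𝕜 E (MeasureTheory.Lp 𝕜 1 μ)) :
    ∃ T : E →L[𝕜] EllOne.{u} 𝕜, ¬ IsOneSumming T := by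
  obtain ⟨j, δ, hδ, hj⟩ := ContinuousLinearMap.exists_lower_bound_of_isIsomorphicToSubspace hEL
  -- Block k has 16^k vectors, later scaled by 8^(-k), and gluing weight 2^(-k). By Cauchy–Schwarz
  -- its weak 1-norm is at most 4^k · 8^(-k) = 2^(-k), which is summable, while its image has total
  -- norm at least 16^k · 8^(-k) · 2^(-k) · δ/10 = δ/10.
  choose y hy1 hy2 using fun k : ℕ =>
    exists_weakly_two_summable_of_not_finiteDimensional hE (16 ^ k)
  -- The vectors `j (y k i)` have norm at least δ/5; an error of δ/10 keeps half of it.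
  choose R hR1 hR using fun k : ℕ => exists_contraction_Lp_one_almost_norm_preserving.{u} μ
    (fun i => j (y k i)) (ε := δ / 10) (by positivity)
  let a : EllOne.{u} 𝕜 := ⟨fun i => (1 / 2 : 𝕜) ^ i.down, memℓp_gen (by
    have h : Summable fun n : ℕ => (1 / 2 : ℝ) ^ n := summable_geometric_two
    simpa [Function.comp_def] using Equiv.ulift.{u}.summable_iff.2 h)⟩
  have ha : ∀ k : ℕ, ‖a ⟨k⟩‖ = (1 / 2 : ℝ) ^ k := fun k => by
    change ‖(1 / 2 : 𝕜) ^ k‖ = _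
    simp
  obtain ⟨S, hS⟩ := exists_glued_operator a (fun i => (R i.down).comp j) (C := ‖j‖) fun i =>
    ((R i.down).opNorm_comp_le j).trans
      (mul_le_of_le_one_left (norm_nonneg _) (hR1 i.down))
  have hSy : ∀ k i, (1 / 2 : ℝ) ^ k * (δ / 10) ≤ ‖S (y k i)‖ := fun k i => by
    refine le_trans ?_ (hS ⟨k⟩ (y k i))
    rw [ha]
    refine mul_le_mul_of_nonneg_left ?_ (by positivity)
    have h1 := hR k i
    have h2 := hj (y k i)
    have h3 := mul_le_mul_of_nonneg_left (hy1 k i) hδ.le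
    change _ ≤ ‖R k (j (y k i))‖
    linarith
  have : Infinite (Σ k : ℕ, Fin (16 ^ k)) :=
    Infinite.of_injective (fun k : ℕ => (⟨k, ⟨0, by positivity⟩⟩ : Σ k : ℕ, Fin (16 ^ k)))
      fun a b h => congrArg Sigma.fst h
  obtain ⟨e⟩ : Nonempty (ℕ ≃ Σ k : ℕ, Fin (16 ^ k)) := nonempty_equiv_of_countable
  let z : (Σ k : ℕ, Fin (16 ^ k)) → E := fun p => ((1 / 8 : 𝕜) ^ p.1) • y p.1 p.2
  refine ⟨S, fun hsum => ?_⟩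
  have hweak : WeaklySummableSeq 𝕜 (z ∘ e) := fun φ => by
    refine (e.summable_iff (f := fun p => ‖φ (z p)‖)).2 ?_
    rw [summable_sigma_of_nonneg fun p => norm_nonneg _]
    refine ⟨fun k => Summable.of_finite, ?_⟩
    refine Summable.of_nonneg_of_le (fun k => tsum_nonneg fun i => norm_nonneg _) (fun k => ?_)
      (summable_geometric_two.mul_right ‖φ‖)
    rw [tsum_fintype]
    have h1 : ∑ i, ‖φ (y k i)‖ ≤ 4 ^ k * ‖φ‖ := by
      refine abs_le_of_sq_le_sq' ?_ (by positivity) |>.2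
      refine sq_sum_le_card_mul_sum_sq.trans ?_
      rw [Finset.card_univ, Fintype.card_fin, mul_pow, ← pow_mul, mul_comm k 2, pow_mul]
      push_cast
      norm_num
      exact hy2 k φ
    calc ∑ i, ‖φ (z ⟨k, i⟩)‖ = (1 / 8) ^ k * ∑ i, ‖φ (y k i)‖ := by
          rw [Finset.mul_sum]
          refine Finset.sum_congr rfl fun i _ => ?_
          simp [z]
      _ ≤ (1 / 8) ^ k * (4 ^ k * ‖φ‖) := by gcongr
      _ = (1 / 2) ^ k * ‖φ‖ := by rw [← mul_assoc, ← mul_pow]; norm_num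
  have h1 : Summable fun p => ‖S (z p)‖ := (e.summable_iff (f := fun p => ‖S (z p)‖)).1 (hsum _ hweak)
  have h2 := ((summable_sigma_of_nonneg fun p => norm_nonneg _).1 h1).2.tendsto_atTop_zero
  have h3 : ∀ k, δ / 10 ≤ ∑' i, ‖S (z ⟨k, i⟩)‖ := fun k => by
    rw [tsum_fintype]
    calc δ / 10 = ∑ _i : Fin (16 ^ k), (1 / 8 : ℝ) ^ k * ((1 / 2) ^ k * (δ / 10)) := by
          rw [Finset.sum_const, Finset.card_univ, Fintype.card_fin, nsmul_eq_mul, ← mul_assoc,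
            ← mul_assoc]
          push_cast
          rw [← mul_pow, ← mul_pow]
          norm_num
      _ ≤ _ := by
          refine Finset.sum_le_sum fun i _ => ?_
          have : ‖S (z ⟨k, i⟩)‖ = (1 / 8 : ℝ) ^ k * ‖S (y k i)‖ := by simp [z, norm_smul]
          rw [this]
          exact mul_le_mul_of_nonneg_left (hSy k i) (by positivity)
  have h4 := ge_of_tendsto' h2 h3
  linarith

end NonSumming

/-! ### Ideal norm versus operator norm -/

section Ideal

theorem BanachOperatorIdeal.nrm_smul_id_scalar {𝕜 : Type} [RCLike 𝕜]
    (I : BanachOperatorIdeal.{u} 𝕜) (c : 𝕜) :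
    I.nrm (c • ContinuousLinearMap.id 𝕜 (ULift.{u} 𝕜)) = ‖c‖ := by
  rw [(I.isBanach _ _).smul c _ I.id_scalar_mem, I.nrm_id_scalar, mul_one]

/-- The ideal norm dominates the operator norm. -/
theorem BanachOperatorIdeal.norm_le_nrm {𝕜 : Type} [RCLike 𝕜] (I : BanachOperatorIdeal.{u} 𝕜)
    {E F : Type u} [NormedAddCommGroup E] [NormedSpace 𝕜 E] [CompleteSpace E]
    [NormedAddCommGroup F] [NormedSpace 𝕜 F] [CompleteSpace F] {T : E →L[𝕜] F}
    (hT : T ∈ I.comp E F) : ‖T‖ ≤ I.nrm T := by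
  have hn := (I.isBanach E F).nonneg T hT
  refine T.opNorm_le_bound hn fun x => ?_
  -- Composing `T` with c ↦ c • x and a norming functional of `T x` gives ‖T x‖ times the scalar
  -- identity, whose ideal norm is known.
  obtain ⟨φ, hφ1, hφ⟩ := exists_dual_vector'' 𝕜 (T x)
  let U : ULift.{u} 𝕜 ≃ₗᵢ[𝕜] 𝕜 := LinearIsometryEquiv.ulift 𝕜 𝕜
  let v : F →L[𝕜] ULift.{u} 𝕜 := (U.symm.toContinuousLinearEquiv : 𝕜 →L[𝕜] ULift.{u} 𝕜).comp φ
  let w : ULift.{u} 𝕜 →L[𝕜] E :=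
    (U.toContinuousLinearEquiv : ULift.{u} 𝕜 →L[𝕜] 𝕜).smulRight x
  have hv : ‖v‖ ≤ 1 := v.opNorm_le_bound zero_le_one fun y => by
    change ‖U.symm (φ y)‖ ≤ _
    rw [LinearIsometryEquiv.norm_map]
    exact φ.le_of_opNorm_le hφ1 y
  have hw : ‖w‖ ≤ ‖x‖ := w.opNorm_le_bound (norm_nonneg x) fun c => by
    change ‖U c • x‖ ≤ _
    rw [norm_smul, LinearIsometryEquiv.norm_map, mul_comm]
  have hcomp : (v.comp T).comp w =
      ((‖T x‖ : ℝ) : 𝕜) • ContinuousLinearMap.id 𝕜 (ULift.{u} 𝕜) := by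
    ext c
    change φ (T (c.down • x)) = ((‖T x‖ : ℝ) : 𝕜) • c.down
    rw [map_smul, map_smul, hφ, smul_eq_mul, smul_eq_mul, mul_comm]
  have h := I.nrm_comp_le v T w hT
  rw [hcomp, I.nrm_smul_id_scalar, RCLike.norm_ofReal, abs_norm] at h
  refine h.trans ?_
  calc ‖v‖ * I.nrm T * ‖w‖ ≤ 1 * I.nrm T * ‖x‖ := by gcongr
    _ = I.nrm T * ‖x‖ := by rw [one_mul]

/-- The range of a linear map which is bounded for the ideal norm and bounded below for the operator
norm is complete for the ideal norm. -/
theorem BanachOperatorIdeal.isBanachUnder_range {𝕜 : Type} [RCLike 𝕜]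
    (I : BanachOperatorIdeal.{u} 𝕜) {E F : Type u}
    [NormedAddCommGroup E] [NormedSpace 𝕜 E] [CompleteSpace E]
    [NormedAddCommGroup F] [NormedSpace 𝕜 F] [CompleteSpace F]
    {X : Type*} [NormedAddCommGroup X] [NormedSpace 𝕜 X] [CompleteSpace X]
    (Φ : X →ₗ[𝕜] E →L[𝕜] F) (hΦ : ∀ a, Φ a ∈ I.comp E F) {C c : ℝ}
    (hC : ∀ a, I.nrm (Φ a) ≤ C * ‖a‖) (hc : 0 < c) (hΦc : ∀ a, c * ‖a‖ ≤ ‖Φ a‖) :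
    IsBanachUnder Φ.range (I.nrm (E := E) (F := F)) := by
  have hI := I.isBanach E F
  have hle : Φ.range ≤ I.comp E F := by
    rintro _ ⟨a, rfl⟩
    exact hΦ a
  refine ⟨fun v hv => hI.nonneg v (hle hv), fun v hv => hI.eq_zero v (hle hv),
    fun k v hv => hI.smul k v (hle hv), fun v hv w hw => hI.add_le v (hle hv) w (hle hw), ?_⟩
  intro x hx hcau
  choose a ha using hx
  have hsub : ∀ m n, x m - x n = Φ (a m - a n) := fun m n => by rw [map_sub, ha, ha]
  have hcs : CauchySeq a := by
    refine Metric.cauchySeq_iff.2 fun ε hε => ?_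
    obtain ⟨n₀, h⟩ := hcau (c * ε) (by positivity)
    refine ⟨n₀, fun m hm n hn => ?_⟩
    rw [dist_eq_norm]
    refine lt_of_mul_lt_mul_left ?_ hc.le
    calc c * ‖a m - a n‖ ≤ ‖Φ (a m - a n)‖ := hΦc _
      _ ≤ I.nrm (Φ (a m - a n)) := I.norm_le_nrm (hΦ _)
      _ < c * ε := by rw [← hsub]; exact h m hm n hn
  obtain ⟨b, hb⟩ := cauchySeq_tendsto_of_complete hcs
  refine ⟨Φ b, ⟨b, rfl⟩, ?_⟩
  have hlim : Filter.Tendsto (fun n => C * ‖a n - b‖) Filter.atTop (nhds 0) := by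
    simpa using (tendsto_iff_norm_sub_tendsto_zero.1 hb).const_mul C
  refine squeeze_zero (fun n => ?_) (fun n => ?_) hlim
  · rw [← ha, ← map_sub]
    exact hI.nonneg _ (hΦ _)
  · rw [← ha, ← map_sub]
    exact hC _

end Ideal

/-! ### The subspace Y as a copy of ℓ₁ -/

theorem mainTheorem3 {𝕜 : Type} [RCLike 𝕜]
    {E F : Type u}
    [NormedAddCommGroup E] [NormedSpace 𝕜 E] [CompleteSpace E]
    [NormedAddCommGroup F] [NormedSpace 𝕜 F] [CompleteSpace F]
    (hE : ¬ FiniteDimensional 𝕜 E)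
    {Ω : Type*} [MeasurableSpace Ω] (μ : MeasureTheory.Measure Ω)
    (hEL : IsIsomorphicToSubspace 𝕜 E (MeasureTheory.Lp 𝕜 1 μ))
    (hF : IsIsomorphicToSubspace 𝕜 (EllOne.{u} 𝕜) F)
    (I : BanachOperatorIdeal.{u} 𝕜)
    (hI : I.MemSpace (EllOne.{u} 𝕜)) :
    ∃ Y : Submodule 𝕜 (E →L[𝕜] F),
      Y ≤ I.comp E F ∧
      ¬ FiniteDimensional 𝕜 Y ∧
      IsBanachUnder Y (I.nrm (E := E) (F := F)) ∧
      ∀ T ∈ Y, T ≠ 0 → ¬ IsOneSumming T := by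
  obtain ⟨T, hT⟩ := exists_not_isOneSumming_into_ellOne.{u} hE μ hEL
  obtain ⟨J, δ, hδ, hJ⟩ := ContinuousLinearMap.exists_lower_bound_of_isIsomorphicToSubspace hF
  obtain ⟨B, hB⟩ := exists_isometric_tensor.{u} 𝕜
  let Φ : EllOne.{u} 𝕜 →ₗ[𝕜] E →L[𝕜] F :=
    { toFun := fun a => (J.comp (B a)).comp T
      map_add' := fun a b => by ext x; simp
      map_smul' := fun k a => by ext x; simp }
  -- Inserting the identity of ℓ₁ exposes the factorisation to which the ideal property applies.
  have hΦeq : ∀ a, Φ a =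
      ((J.comp (B a)).comp (ContinuousLinearMap.id 𝕜 (EllOne.{u} 𝕜))).comp T := fun a => rfl
  have hΦx : ∀ a x, δ * ‖a‖ * ‖T x‖ ≤ ‖Φ a x‖ := fun a x => by
    have h := hJ (B a (T x))
    rwa [hB, ← mul_assoc] at h
  have hBa : ∀ a, ‖B a‖ ≤ ‖a‖ := fun a =>
    (B a).opNorm_le_bound (norm_nonneg a) fun x => (hB a x).le
  have hΦ : ∀ a, Φ a ∈ I.comp E F := fun a => by
    rw [hΦeq]
    exact I.comp_mem _ _ _ hI
  have hid : 0 ≤ I.nrm (ContinuousLinearMap.id 𝕜 (EllOne.{u} 𝕜)) := (I.isBanach _ _).nonneg _ hI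
  have hC : ∀ a, I.nrm (Φ a) ≤
      ‖J‖ * I.nrm (ContinuousLinearMap.id 𝕜 (EllOne.{u} 𝕜)) * ‖T‖ * ‖a‖ := fun a => by
    rw [hΦeq]
    refine (I.nrm_comp_le _ _ _ hI).trans ?_
    calc ‖J.comp (B a)‖ * I.nrm (ContinuousLinearMap.id 𝕜 (EllOne.{u} 𝕜)) * ‖T‖
        ≤ (‖J‖ * ‖a‖) * I.nrm (ContinuousLinearMap.id 𝕜 (EllOne.{u} 𝕜)) * ‖T‖ := by
          gcongr
          exact (J.opNorm_comp_le (B a)).trans (by gcongr; exact hBa a)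
      _ = _ := by ring
  obtain ⟨x₀, hx₀⟩ : ∃ x, T x ≠ 0 := by
    by_contra! h
    exact hT fun x _ => by simp [h]
  have hx₀' : 0 < ‖x₀‖ := norm_pos_iff.2 fun h => hx₀ (by rw [h, map_zero])
  have hTx₀ : 0 < ‖T x₀‖ := norm_pos_iff.2 hx₀
  have hlow : ∀ a, δ * ‖T x₀‖ / ‖x₀‖ * ‖a‖ ≤ ‖Φ a‖ := fun a => by
    rw [div_mul_eq_mul_div, div_le_iff₀ hx₀']
    calc δ * ‖T x₀‖ * ‖a‖ = δ * ‖a‖ * ‖T x₀‖ := by ring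
      _ ≤ ‖Φ a x₀‖ := hΦx a x₀
      _ ≤ ‖Φ a‖ * ‖x₀‖ := (Φ a).le_opNorm x₀
  have hpos : 0 < δ * ‖T x₀‖ / ‖x₀‖ := by positivity
  have hinj : Function.Injective Φ := by
    rw [injective_iff_map_eq_zero]
    intro a ha
    have h := hlow a
    rw [ha, norm_zero] at h
    exact norm_le_zero_iff.1 (nonpos_of_mul_nonpos_right h hpos)
  refine ⟨Φ.range, ?_, ?_, I.isBanachUnder_range Φ hΦ hC hpos hlow, ?_⟩
  · rintro _ ⟨a, rfl⟩
    exact hΦ a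
  · intro h
    exact EllOne.not_finiteDimensional.{u} 𝕜 (LinearEquiv.ofInjective Φ hinj).symm.finiteDimensional
  · rintro _ ⟨a, rfl⟩ ha hsum
    have ha0 : 0 < ‖a‖ := norm_pos_iff.2 fun h => ha (by rw [h, map_zero])
    refine hT fun x hx => ?_
    have h := (hsum x hx).mul_left (δ * ‖a‖)⁻¹
    refine Summable.of_nonneg_of_le (fun n => norm_nonneg _) (fun n => ?_) h
    rw [le_inv_mul_iff₀ (by positivity)]
    exact hΦx a (x n)
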